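/- Let $T$ be an $L$-theory and let $\varphi(x;t)$ be an $L$-formula, with $x$ and $t$ finite tuples of variables, which is NIP in $T$; that is, there is $k\in\mathbb N$ such that in no model $M$ of $T$ is there a set $A\subseteq M^{|x|}$ with exactly $k$ elements all of whose subsets are of the form $A\cap\varphi(M;b)$ with $b\in M^{|t|}$. Call two subsets $X,Y$ of $M^{|x|}$ *externally $\varphi$-separable* if there are an elementary extension $N\succeq M$ and a tuple $a$ in $N$ such that $X\subseteq\varphi(M;a)$ and $Y\cap\varphi(M;a)=\emptyset$, where $\varphi(M;a)=\{c\in M^{|x|} : N\models\varphi(c;a)\}$. Let $U(x)$ and $V(x)$ be two new $|x|$-ary predicate symbols and let $L_{U,V}=L\cup\{U,V\}$. Then there are an $L_{U,V}$-sentence $\theta$ and an $L$-formula $\psi(x;s)$, with $s$ a finite tuple of variables, such that for every model $M$ of $T$ and every enrichment $M_{U,V}$ of $M$ to $L_{U,V}$ the following hold: 1. if (the interpretations of) $U$ and $V$ are externally $\varphi$-separable, then $M_{U,V}\models\theta$; 2. if $M_{U,V}\models\theta$, then $U$ and $V$ are externally $\psi$-separable. -/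

import Mathlib

open scoped FirstOrder

universe u v w

namespace ExtSep

/-- The set of `n`-tuples `A` is shattered by `φ(x;t)` in `M`: every subset `B` of `A` is cut out
on `A` by an instance `φ(x;b)` with `b` a tuple from `M`. -/
def Shatters {L : FirstOrder.Language.{u, v}} {n m : ℕ} (φ : L.Formula (Fin n ⊕ Fin m))
    {M : Type w} [L.Structure M] (A : Set (Fin n → M)) : Prop :=
  ∀ B ⊆ A, ∃ b : Fin m → M, ∀ a ∈ A, φ.Realize (Sum.elim a b) ↔ a ∈ B

/-- `φ(x;t)` is NIP with respect to `T`: for some `k`, no set of `k` many `x`-tuples of a model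
of `T` is shattered by `φ(x;t)`. -/
def IsNIP {L : FirstOrder.Language.{u, v}} (T : L.Theory) {n m : ℕ} (φ : L.Formula (Fin n ⊕ Fin m)) : Prop :=
  ∃ k : ℕ, ∀ (M : Type w) [L.Structure M] [Nonempty M] [M ⊨ T] (A : Finset (Fin n → M)),
    A.card = k → ¬ Shatters φ (A : Set (Fin n → M))

/-- `X` and `Y` are externally `φ`-separable: there are an elementary extension `N` of `M` and a
tuple `a` from `N` with `X ⊆ φ(M;a)` and `Y ∩ φ(M;a) = ∅`. -/
def ExternallySeparable {L : FirstOrder.Language.{u, v}} {n m : ℕ} (φ : L.Formula (Fin n ⊕ Fin m))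
    {M : Type w} [L.Structure M] (X Y : Set (Fin n → M)) : Prop :=
  ∃ (N : Type w) (_ : L.Structure N) (f : M ↪ₑ[L] N) (a : Fin m → N),
    X ⊆ {x | φ.Realize (Sum.elim (f ∘ x) a)} ∧ Y ∩ {x | φ.Realize (Sum.elim (f ∘ x) a)} = ∅

/-- Two `n`-ary relation symbols `U` and `V`. -/
inductive UVRel (n : ℕ) : ℕ → Type
  | U : UVRel n n
  | V : UVRel n n

/-- The language whose only symbols are the two `n`-ary predicates `U` and `V`. -/
def langUV (n : ℕ) : FirstOrder.Language.{0, 0} := ⟨fun _ => Empty, UVRel n⟩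

/-- The language `L ∪ {U, V}`, with `U` and `V` new `n`-ary predicates. -/
abbrev withUV (L : FirstOrder.Language.{u, v}) (n : ℕ) : FirstOrder.Language.{u, v} := L.sum (langUV n)

/-- The interpretation of the symbols `U` and `V` by two given sets of `n`-tuples. -/
@[reducible]
def structureUV {n : ℕ} {M : Type w} (U V : Set (Fin n → M)) : (langUV n).Structure M where
  funMap := fun f _ => nomatch f
  RelMap := fun r x =>
    match r, x with
    | UVRel.U, x => x ∈ U
    | UVRel.V, x => x ∈ V

/-- The enrichment of the `L`-structure `M` to `L ∪ {U, V}` given by two sets of `n`-tuples. -/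
@[reducible]
def enrichment (L : FirstOrder.Language.{u, v}) {n : ℕ} {M : Type w} [L.Structure M]
    (U V : Set (Fin n → M)) : (withUV L n).Structure M :=
  letI := structureUV U V
  FirstOrder.Language.sumStructure L (langUV n) M

/-- The sentence `θ` of `L ∪ {U, V}` holds in the enrichment of `M` by `U` and `V`. -/
def EnrichmentModels {L : FirstOrder.Language.{u, v}} {n : ℕ} {M : Type w} [L.Structure M]
    (U V : Set (Fin n → M)) (θ : (withUV L n).Sentence) : Prop :=
  letI := enrichment L U V
  M ⊨ θ

end ExtSep

namespace ExtSep

open Finset Filter Topology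

/-! ### Shattering, duality and the number of traces -/

section Combinatorics

variable {X B : Type*}

/-- Some `k` points are shattered by the sets `{x | R x b}`. -/
def FinShatters (R : X → B → Prop) (k : ℕ) : Prop :=
  ∃ x : Fin k → X, ∀ s : Set (Fin k), ∃ b, ∀ i, R (x i) b ↔ i ∈ s

theorem FinShatters.of_comp {Y : Type*} {R : X → B → Prop} {k : ℕ} (f : Y → X)
    (h : FinShatters (fun y b => R (f y) b) k) : FinShatters R k :=
  let ⟨x, hx⟩ := h
  ⟨f ∘ x, hx⟩

/-- Index the `2 ^ k` shattered parameters by the subsets of `Fin k`; the point cutting out the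
subsets that contain `i` serves as `x i`. -/
theorem FinShatters.of_swap {R : X → B → Prop} {k : ℕ}
    (h : FinShatters (fun b x => R x b) (2 ^ k)) : FinShatters R k := by
  obtain ⟨y, hy⟩ := h
  have e : Fin (2 ^ k) ≃ Set (Fin k) := Fintype.equivOfCardEq (by simp)
  choose x hx using fun i : Fin k => hy {j | i ∈ e j}
  exact ⟨x, fun s => ⟨y (e.symm s), fun i => by simpa using hx i (e.symm s)⟩⟩

open Classical in
/-- The **Sauer–Shelah lemma**, with a crude polynomial bound. -/
theorem exists_traces [Fintype X] {R : X → B → Prop} {k : ℕ} (h : ¬ FinShatters R k) :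
    ∃ 𝒜 : Finset (Finset X), #𝒜 ≤ (k + 1) * (Fintype.card X + 1) ^ k ∧
      ∀ b, univ.filter (fun x => R x b) ∈ 𝒜 := by
  refine ⟨univ.filter fun s => ∃ b, s = univ.filter fun x => R x b, ?_,
    fun b => mem_filter.2 ⟨mem_univ _, b, rfl⟩⟩
  set 𝒜 : Finset (Finset X) := univ.filter fun s => ∃ b, s = univ.filter fun x => R x b with h𝒜
  have hdim : 𝒜.vcDim ≤ k := by
    refine Finset.sup_le fun s hs => ?_
    by_contra! hk
    obtain ⟨t, hts, htk⟩ := exists_subset_card_eq hk.le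
    have ht : 𝒜.Shatters t := (mem_shatterer.1 hs).mono_right hts
    refine h ⟨fun i => (t.equivFinOfCardEq htk).symm i, fun s => ?_⟩
    obtain ⟨c, hc, hcs⟩ := @ht (t.filter fun x => ∃ i ∈ s, ((t.equivFinOfCardEq htk).symm i : X) = x)
      (filter_subset _ _)
    obtain ⟨b, rfl⟩ := (mem_filter.1 hc).2
    refine ⟨b, fun i => ?_⟩
    have := Finset.ext_iff.1 hcs ((t.equivFinOfCardEq htk).symm i)
    simp only [mem_inter, coe_mem, mem_filter, mem_univ, true_and] at this
    rw [this]
    constructor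
    · rintro ⟨j, hj, hji⟩
      have := (t.equivFinOfCardEq htk).symm.injective (Subtype.ext hji)
      exact this ▸ hj
    · exact fun hi => ⟨i, hi, rfl⟩
  calc #𝒜 ≤ #𝒜.shatterer := card_le_card_shatterer _
    _ ≤ ∑ j ∈ Iic 𝒜.vcDim, (Fintype.card X).choose j := card_shatterer_le_sum_vcDim
    _ ≤ ∑ j ∈ Iic k, (Fintype.card X).choose j :=
        sum_le_sum_of_subset (Iic_subset_Iic.2 hdim)
    _ ≤ ∑ j ∈ Iic k, (Fintype.card X + 1) ^ k := by
        refine sum_le_sum fun j hj => ?_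
        calc (Fintype.card X).choose j ≤ (Fintype.card X) ^ j := Nat.choose_le_pow _ _
          _ ≤ (Fintype.card X + 1) ^ j := Nat.pow_le_pow_left (Nat.le_succ _) _
          _ ≤ _ := Nat.pow_le_pow_right (Nat.succ_pos _) (mem_Iic.1 hj)
    _ = _ := by simp

/-! ### Approximations of bounded size by repeated random halving -/

/-- The exponential moment bound for sums of independent random signs. -/
theorem sum_exp_signs_le {ι : Type*} [Fintype ι] [DecidableEq ι] (a : ι → ℝ)
    (ha : ∀ j, |a j| ≤ 1) (t : ℝ) :
    ∑ σ : ι → Bool, Real.exp (t * ∑ j, (if σ j then a j else - a j)) ≤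
      2 ^ Fintype.card ι * Real.exp (Fintype.card ι * t ^ 2 / 2) := by
  have h1 : ∀ σ : ι → Bool, Real.exp (t * ∑ j, (if σ j then a j else - a j)) =
      ∏ j, Real.exp (t * (if σ j then a j else - a j)) := fun σ => by
    rw [mul_sum, Real.exp_sum]
  simp_rw [h1]
  rw [← Fintype.prod_sum (fun j (s : Bool) => Real.exp (t * (if s then a j else - a j)))]
  calc ∏ j, ∑ s : Bool, Real.exp (t * (if s then a j else - a j))
      ≤ ∏ _j : ι, (2 * Real.exp (t ^ 2 / 2)) := by
        refine prod_le_prod (fun j _ => sum_nonneg fun s _ => (Real.exp_pos _).le) fun j _ => ?_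
        have h2 := Real.cosh_le_exp_half_sq (t * a j)
        have h3 : (t * a j) ^ 2 / 2 ≤ t ^ 2 / 2 := by
          have : a j ^ 2 ≤ 1 := (sq_le_one_iff_abs_le_one _).2 (ha j)
          rw [mul_pow]
          nlinarith [sq_nonneg t]
        have h4 := h2.trans (Real.exp_le_exp.2 h3)
        rw [Real.cosh_eq] at h4
        simp only [Fintype.sum_bool, if_true, Bool.false_eq_true, if_false, mul_neg]
        linarith
    _ = _ := by
        rw [prod_const, card_univ, mul_pow, ← Real.exp_nat_mul]
        ring_nf

open Classical in
/-- A choice of one point from each of `n` pairs halves each of few sets up to a small error. -/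
theorem exists_halving {ι : Type*} [Fintype ι] (𝒜 : Finset (Finset (ι × Bool))) {ε : ℝ}
    (hε : 0 < ε) (h : 2 * (#𝒜 : ℝ) ≤ Real.exp (2 * Fintype.card ι * ε ^ 2)) :
    ∃ σ : ι → Bool, ∀ c ∈ 𝒜,
      |2 * (∑ j, if (j, σ j) ∈ c then (1 : ℝ) else 0) - ∑ p, if p ∈ c then (1 : ℝ) else 0| ≤
        2 * Fintype.card ι * ε := by
  set n : ℝ := (Fintype.card ι : ℝ)
  let a : Finset (ι × Bool) → ι → ℝ := fun c j =>
    (if (j, true) ∈ c then (1 : ℝ) else 0) - if (j, false) ∈ c then (1 : ℝ) else 0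
  let S : Finset (ι × Bool) → (ι → Bool) → ℝ := fun c σ => ∑ j, if σ j then a c j else - a c j
  have hS : ∀ c σ, 2 * (∑ j, if (j, σ j) ∈ c then (1 : ℝ) else 0) -
      (∑ p, if p ∈ c then (1 : ℝ) else 0) = S c σ := fun c σ => by
    rw [Fintype.sum_prod_type, mul_sum, ← sum_sub_distrib]
    refine sum_congr rfl fun j _ => ?_
    rw [Fintype.sum_bool]
    cases hσ : σ j <;> simp only [a, Bool.false_eq_true, if_true, if_false] <;> split_ifs <;> norm_num
  have ha : ∀ c j, |a c j| ≤ 1 := fun c j => by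
    simp only [a]; split_ifs <;> norm_num
  have hpos : ∀ t : ℝ, ∀ c, ∑ σ, Real.exp (t * S c σ) ≤ 2 ^ Fintype.card ι *
      Real.exp (n * t ^ 2 / 2) := fun t c => sum_exp_signs_le (a c) (ha c) t
  have htot : ∑ σ : ι → Bool, ∑ c ∈ 𝒜, (Real.exp (2 * ε * S c σ) + Real.exp (-(2 * ε) * S c σ)) ≤
      ∑ σ : ι → Bool, 2 * #𝒜 * Real.exp (2 * n * ε ^ 2) := by
    rw [sum_comm]
    calc _ ≤ ∑ c ∈ 𝒜, 2 * (2 ^ Fintype.card ι * Real.exp (2 * n * ε ^ 2)) := by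
          refine sum_le_sum fun c _ => ?_
          rw [sum_add_distrib]
          have h1 := hpos (2 * ε) c
          have h2 := hpos (-(2 * ε)) c
          rw [show n * (2 * ε) ^ 2 / 2 = 2 * n * ε ^ 2 by ring] at h1
          rw [show n * (-(2 * ε)) ^ 2 / 2 = 2 * n * ε ^ 2 by ring] at h2
          linarith
      _ = _ := by
          simp
          ring
  -- Some `σ` does no worse than average. The exponent `2 * ε` minimises the resulting union bound.
  obtain ⟨σ, -, hσ⟩ := exists_le_of_sum_le (univ_nonempty (α := ι → Bool)) htot
  refine ⟨σ, fun c hc => ?_⟩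
  rw [hS]
  have h1 : Real.exp (2 * ε * S c σ) + Real.exp (-(2 * ε) * S c σ) ≤
      Real.exp (2 * ε * (2 * n * ε)) := by
    refine (single_le_sum (f := fun c => Real.exp (2 * ε * S c σ) + Real.exp (-(2 * ε) * S c σ))
      (fun c _ => by positivity) hc).trans (hσ.trans ?_)
    rw [show 2 * ε * (2 * n * ε) = 2 * n * ε ^ 2 + 2 * n * ε ^ 2 by ring, Real.exp_add]
    gcongr
  have h2 := Real.exp_pos (2 * ε * S c σ)
  have h3 := Real.exp_pos (-(2 * ε) * S c σ)
  have h4 : 2 * ε * S c σ ≤ 2 * ε * (2 * n * ε) := Real.exp_le_exp.1 (by linarith)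
  have h5 : -(2 * ε) * S c σ ≤ 2 * ε * (2 * n * ε) := Real.exp_le_exp.1 (by linarith)
  rw [abs_le]
  constructor <;> nlinarith

open Classical in
/-- The fraction of the points `f j` with `R (f j) b`. -/
noncomputable def freq (R : X → B → Prop) {ι : Type*} [Fintype ι] (f : ι → X) (b : B) : ℝ :=
  (∑ j, if R (f j) b then (1 : ℝ) else 0) / Fintype.card ι

theorem freq_equiv (R : X → B → Prop) {ι κ : Type*} [Fintype ι] [Fintype κ] (e : ι ≃ κ)
    (f : κ → X) (b : B) : freq R (f ∘ e) b = freq R f b := by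
  unfold freq
  rw [Fintype.card_congr e]
  congr 1
  exact Fintype.sum_equiv e _ _ fun _ => rfl

/-- Pair up the points and keep one of each pair: `exists_traces` leaves only polynomially many sets
to be halved. -/
theorem exists_freq_half {R : X → B → Prop} {k r : ℕ} (h : ¬ FinShatters R k) {ε : ℝ} (hε : 0 < ε)
    (hr : 2 * ((k + 1) * (2 ^ (r + 1) + 1) ^ k : ℝ) ≤ Real.exp (2 * 2 ^ r * ε ^ 2))
    (f : Fin (2 ^ (r + 1)) → X) :
    ∃ g : Fin (2 ^ r) → X, ∀ b, |freq R g b - freq R f b| ≤ ε := by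
  classical
  have e : Fin (2 ^ r) × Bool ≃ Fin (2 ^ (r + 1)) :=
    Fintype.equivOfCardEq (by simp [pow_succ])
  obtain ⟨𝒜, h𝒜, hmem⟩ := exists_traces
    (fun h' : FinShatters (fun p b => R (f (e p)) b) k => h (h'.of_comp (f ∘ e)))
  obtain ⟨σ, hσ⟩ := exists_halving 𝒜 hε (by
    refine le_trans ?_ (hr.trans (by simp))
    have : (#𝒜 : ℝ) ≤ ((k + 1) * (Fintype.card (Fin (2 ^ r) × Bool) + 1) ^ k : ℕ) := by
      exact_mod_cast h𝒜
    simp only [Fintype.card_prod, Fintype.card_fin, Fintype.card_bool, ← pow_succ] at this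
    push_cast at this
    linarith)
  refine ⟨fun j => f (e (j, σ j)), fun b => ?_⟩
  have := hσ _ (hmem b)
  rw [← freq_equiv R e f]
  simp only [freq, Function.comp_apply, Fintype.card_prod, Fintype.card_fin, Fintype.card_bool,
    mem_filter, mem_univ, true_and] at this ⊢
  have hp : (0 : ℝ) < 2 ^ r := by positivity
  push_cast at this ⊢
  generalize (∑ j, if R (f (e (j, σ j))) b then (1 : ℝ) else 0) = p at *
  generalize (∑ p, if R (f (e p)) b then (1 : ℝ) else 0) = q at *
  rw [show p / 2 ^ r - q / (2 ^ r * 2) = (2 * p - q) / (2 * 2 ^ r) by field_simp, abs_div,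
    abs_of_pos (by positivity : (0 : ℝ) < 2 * 2 ^ r), div_le_iff₀ (by positivity)]
  linarith

/-- The errors `(9 / 10) ^ r` are summable, yet `2 * (9 / 10) ^ 2 > 1`, so the right-hand exponent
grows exponentially in `r` while the logarithm of the left side is linear. -/
theorem eventually_bound (k : ℕ) : ∀ᶠ r : ℕ in atTop,
    2 * ((k + 1) * (2 ^ (r + 1) + 1) ^ k : ℝ) ≤ Real.exp (2 * 2 ^ r * ((9 / 10) ^ r) ^ 2) := by
  have h1 := (tendsto_pow_const_div_const_pow_of_one_lt 1 (r := (81 / 50 : ℝ))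
    (by norm_num)).const_mul (k : ℝ)
  have h2 := (tendsto_pow_const_div_const_pow_of_one_lt 0 (r := (81 / 50 : ℝ))
    (by norm_num)).const_mul (3 * k + 1 : ℝ)
  have h3 := (h1.add h2).eventually (gt_mem_nhds (show (k : ℝ) * 0 + (3 * k + 1) * 0 < 1 by simp))
  filter_upwards [h3] with r hr
  have hp : (0 : ℝ) < (81 / 50) ^ r := by positivity
  have hexp : (2 * 2 ^ r * ((9 / 10) ^ r) ^ 2 : ℝ) = 2 * (81 / 50) ^ r := by
    rw [← pow_mul, mul_comm r 2, pow_mul, mul_assoc, ← mul_pow]; norm_num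
  rw [hexp]
  have h4 : (k : ℝ) * r + (3 * k + 1) < (81 / 50) ^ r := by
    have : (k : ℝ) * (r ^ 1 / (81 / 50) ^ r) + (3 * k + 1) * (r ^ 0 / (81 / 50) ^ r) =
      (k * r + (3 * k + 1)) / (81 / 50) ^ r := by field_simp
    rw [this, div_lt_one hp] at hr
    exact hr
  have h5 : (2 : ℝ) ≤ Real.exp 1 := by have := Real.add_one_le_exp (1 : ℝ); linarith
  have h6 : ((k : ℝ) + 1) ≤ 2 ^ k := by exact_mod_cast Nat.lt_two_pow_self
  have h7 : (2 ^ (r + 1) + 1 : ℝ) ≤ 2 ^ (r + 2) := by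
    have : (1 : ℝ) ≤ 2 ^ r := one_le_pow₀ (by norm_num)
    rw [pow_succ, pow_add]; linarith
  calc 2 * (((k : ℝ) + 1) * (2 ^ (r + 1) + 1) ^ k) ≤ 2 * (2 ^ k * (2 ^ (r + 2)) ^ k) := by gcongr
    _ = 2 ^ (k * r + (3 * k + 1)) := by rw [← pow_mul]; ring
    _ ≤ Real.exp 1 ^ (k * r + (3 * k + 1)) := by gcongr
    _ = Real.exp (k * r + (3 * k + 1)) := by rw [← Real.exp_nat_mul]; push_cast; ring_nf
    _ ≤ _ := Real.exp_le_exp.2 (by linarith)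

/-- Iterated halving; the factor 10 is `1 / (1 - 9 / 10)`, which makes the geometric errors
telescope. -/
theorem exists_freq_reduce {R : X → B → Prop} {k r : ℕ} (h : ¬ FinShatters R k)
    (hr : ∀ s ≥ r, 2 * ((k + 1) * (2 ^ (s + 1) + 1) ^ k : ℝ) ≤
      Real.exp (2 * 2 ^ s * ((9 / 10) ^ s) ^ 2)) (s : ℕ) (f : Fin (2 ^ (r + s)) → X) :
    ∃ g : Fin (2 ^ r) → X, ∀ b,
      |freq R g b - freq R f b| ≤ 10 * ((9 / 10) ^ r - (9 / 10) ^ (r + s)) := by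
  induction s with
  | zero => exact ⟨f, fun b => by simp⟩
  | succ s ih =>
    obtain ⟨f', hf'⟩ := exists_freq_half h (by positivity) (hr (r + s) (Nat.le_add_right _ _)) f
    obtain ⟨g, hg⟩ := ih f'
    refine ⟨g, fun b => (abs_sub_le _ (freq R f' b) _).trans ((add_le_add (hg b) (hf' b)).trans ?_)⟩
    rw [← add_assoc, pow_succ]
    linarith

open Classical in
/-- The measure of `{x | R x b}` for the weight `w`. -/
noncomputable def mass [Fintype X] (R : X → B → Prop) (w : X → ℝ) (b : B) : ℝ :=
  ∑ x, w x * if R x b then (1 : ℝ) else 0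

/-- Repeat `x` about `n * w x` times, rounding down, and fill the remaining places with a fixed
`x₀`. The dependence on the size of `X` is harmless, as `n` is later taken huge and then halved
down. -/
theorem exists_freq_near_mass [Fintype X] (R : X → B → Prop) {w : X → ℝ} (hw : ∀ x, 0 ≤ w x)
    (hw1 : ∑ x, w x = 1) {n : ℕ} (hn : 0 < n) :
    ∃ f : Fin n → X, ∀ b, |freq R f b - mass R w b| ≤ Fintype.card X / n := by
  classical
  have hX : Nonempty X := by
    by_contra hX
    rw [not_nonempty_iff] at hX
    simp at hw1
  obtain ⟨x₀⟩ := hX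
  let m : X → ℕ := fun x => ⌊n * w x⌋₊
  have hm1 : ∀ x, (m x : ℝ) ≤ n * w x := fun x => Nat.floor_le (mul_nonneg n.cast_nonneg (hw x))
  have hm2 : ∀ x, n * w x < m x + 1 := fun x => Nat.lt_floor_add_one _
  have hsum : (∑ x, (m x : ℝ)) ≤ n := by
    calc _ ≤ ∑ x, n * w x := sum_le_sum fun x _ => hm1 x
      _ = n := by rw [← mul_sum, hw1, mul_one]
  have hsum' : ∑ x, m x ≤ n := by exact_mod_cast hsum
  have hrest : ((n - ∑ x, m x : ℕ) : ℝ) = ∑ x, (n * w x - m x) := by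
    rw [Nat.cast_sub hsum', sum_sub_distrib, ← mul_sum, hw1]; push_cast; ring
  have e : Fin n ≃ (Σ x, Fin (m x)) ⊕ Fin (n - ∑ x, m x) :=
    Fintype.equivOfCardEq (by simp [hsum'])
  refine ⟨Sum.elim (fun p => p.1) (fun _ => x₀) ∘ e, fun b => ?_⟩
  have hn' : (0 : ℝ) < n := by exact_mod_cast hn
  rw [freq_equiv, freq, ← Fintype.card_congr e, Fintype.card_fin, Fintype.sum_sum_type,
    Fintype.sum_sigma]
  change |((∑ x, ∑ _y : Fin (m x), if R x b then (1 : ℝ) else 0) +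
    ∑ _y : Fin (n - ∑ x, m x), if R x₀ b then (1 : ℝ) else 0) / n - _| ≤ _
  simp only [sum_const, card_univ, Fintype.card_fin, nsmul_eq_mul, hrest]
  rw [← mul_div_cancel_left₀ (mass R w b) hn'.ne', ← sub_div, abs_div, abs_of_pos hn',
    div_le_div_iff_of_pos_right hn', mass, mul_sum, add_sub_right_comm, ← sum_sub_distrib]
  have h0 : ∀ x, 0 ≤ n * w x - m x := fun x => by linarith [hm1 x]
  have h1 : ∑ x, (n * w x - m x) ≤ Fintype.card X := by
    calc _ ≤ ∑ _x : X, (1 : ℝ) := sum_le_sum fun x _ => by linarith [hm2 x]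
      _ = _ := by simp
  have h2 : -∑ x, (n * w x - m x) ≤ ∑ x, ((m x * if R x b then (1 : ℝ) else 0) -
      n * (w x * if R x b then (1 : ℝ) else 0)) := by
    rw [← sum_neg_distrib]
    refine sum_le_sum fun x _ => ?_
    split_ifs <;> linarith [h0 x]
  have h3 : ∑ x, ((m x * if R x b then (1 : ℝ) else 0) -
      n * (w x * if R x b then (1 : ℝ) else 0)) ≤ 0 :=
    sum_nonpos fun x _ => by split_ifs <;> linarith [h0 x]
  have h4 : 0 ≤ ∑ x, (n * w x - m x) := sum_nonneg fun x _ => h0 x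
  rw [abs_le]
  split_ifs <;> constructor <;> linarith

/-- **Vapnik–Chervonenkis**: a family of sets that does not shatter `k` points has
`ε`-approximations of size bounded in terms of `k` and `ε`. -/
theorem exists_approximation (k : ℕ) {ε : ℝ} (hε : 0 < ε) :
    ∃ r : ℕ, ∀ {X : Type u} {B : Type v} [Fintype X] {R : X → B → Prop}, ¬ FinShatters R k →
      ∀ w : X → ℝ, (∀ x, 0 ≤ w x) → ∑ x, w x = 1 →
        ∃ f : Fin (2 ^ r) → X, ∀ b, |freq R f b - mass R w b| < ε := by
  have h1 : Tendsto (fun r : ℕ => 10 * (9 / 10 : ℝ) ^ r) atTop (𝓝 (10 * 0)) :=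
    (tendsto_pow_atTop_nhds_zero_of_lt_one (by norm_num) (by norm_num)).const_mul _
  have h2 := h1.eventually (gt_mem_nhds (show (10 : ℝ) * 0 < ε / 2 by simpa using hε))
  obtain ⟨r, hr⟩ := eventually_atTop.1 ((eventually_bound k).and h2)
  refine ⟨r, fun {X B _ R} hR w hw hw1 => ?_⟩
  obtain ⟨s, hs⟩ := pow_unbounded_of_one_lt (2 * Fintype.card X / ε) (one_lt_two (α := ℝ))
  obtain ⟨f, hf⟩ := exists_freq_near_mass R hw hw1 (n := 2 ^ (r + s)) (by positivity)
  obtain ⟨g, hg⟩ := exists_freq_reduce hR (fun s hs => (hr s hs).1) s f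
  refine ⟨g, fun b => ?_⟩
  have h3 : (Fintype.card X : ℝ) / (2 ^ (r + s) : ℕ) ≤ ε / 2 := by
    push_cast
    rw [div_lt_iff₀ hε] at hs
    rw [div_le_iff₀ (by positivity), pow_add]
    have : (1 : ℝ) ≤ 2 ^ r := one_le_pow₀ (by norm_num)
    have h5 : (2 : ℝ) ^ s * ε ≤ 2 ^ r * (2 ^ s * ε) := le_mul_of_one_le_left (by positivity) this
    nlinarith
  have h4 : (0 : ℝ) < (9 / 10) ^ (r + s) := by positivity
  have h5 := (hr r le_rfl).2
  calc _ ≤ _ := abs_sub_le _ (freq R f b) _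
    _ ≤ _ := add_le_add (hg b) ((hf b).trans h3)
    _ < ε := by linarith

/-! ### Minimax and majority votes -/

open Classical in
/-- A form of the **minimax theorem**. -/
theorem exists_mixed_strategy [Fintype X] [Nonempty B] (R : X → B → Prop) (c : ℝ)
    (h : ∀ w : X → ℝ, (∀ x, 0 ≤ w x) → ∑ x, w x = 1 → ∃ b, c ≤ mass R w b) :
    ∃ (ι : Type) (_ : Fintype ι) (w : ι → ℝ) (b : ι → B), (∀ i, 0 ≤ w i) ∧ ∑ i, w i = 1 ∧
      ∀ x, c ≤ mass (fun i x => R x (b i)) w x := by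
  let g : B → X → ℝ := fun b x => if R x b then 1 else 0
  have hfin : (Set.range g).Finite := by
    refine (Set.finite_range fun (s : Set X) x => if x ∈ s then (1 : ℝ) else 0).subset ?_
    rintro _ ⟨b, rfl⟩
    exact ⟨{x | R x b}, rfl⟩
  -- If the hull of the payoff vectors misses the orthant above `c`, a separating functional,
  -- normalised, is a weight giving every `b` mass below `c`.
  by_cases hd : Disjoint (convexHull ℝ (Set.range g)) (Set.Ici fun _ => c)
  · exfalso
    obtain ⟨F, u, v, hu, huv, hv⟩ := geometric_hahn_banach_compact_closed
      (convex_convexHull ℝ _) (hfin.isCompact_convexHull ℝ) (convex_Ici _) isClosed_Ici hd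
    let w : X → ℝ := fun x => F (Pi.single x 1)
    have hF : ∀ y : X → ℝ, F y = ∑ x, w x * y x := fun y => by
      conv_lhs => rw [← univ_sum_single y, map_sum]
      refine sum_congr rfl fun x _ => ?_
      have : (Pi.single x (y x) : X → ℝ) = y x • Pi.single x 1 := by
        rw [← Pi.single_smul]; simp
      rw [this, map_smul, smul_eq_mul, mul_comm]
    have hw : ∀ x, 0 ≤ w x := by
      intro x
      by_contra! hx
      -- Moving this far along a coordinate of negative weight stays in the orthant but brings `F`
      -- down to at most `v`.
      let t : ℝ := max 0 ((v - F fun _ => c) / w x)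
      have ht : 0 ≤ t := le_max_left _ _
      have := hv ((fun _ => c) + t • Pi.single x 1) (by
        refine Set.mem_Ici.2 (le_add_of_nonneg_right (smul_nonneg ht ?_))
        exact Pi.single_nonneg.2 zero_le_one)
      rw [map_add, map_smul, smul_eq_mul] at this
      have h2 : (v - F fun _ => c) / w x ≤ t := le_max_right _ _
      rw [div_le_iff_of_neg hx] at h2
      change v < _ + t * w x at this
      linarith
    have hgu : ∀ b, F (g b) < u := fun b => hu _ (subset_convexHull ℝ _ ⟨b, rfl⟩)
    have hc := hv (fun _ => c) Set.self_mem_Ici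
    rw [hF, ← sum_mul] at hc
    rcases (sum_nonneg fun x (_ : x ∈ univ) => hw x).eq_or_lt with h0 | h0
    · have hz : ∀ x, w x = 0 := fun x =>
        (sum_eq_zero_iff_of_nonneg fun x _ => hw x).1 h0.symm x (mem_univ x)
      have := hgu (Classical.arbitrary B)
      rw [hF] at this
      simp only [hz, zero_mul, sum_const_zero] at this hc
      linarith
    · obtain ⟨b, hb⟩ := h (fun x => w x / ∑ x, w x) (fun x => div_nonneg (hw x) h0.le)
        (by rw [← sum_div, div_self h0.ne'])
      have := hgu b
      rw [hF] at this
      simp only [mass, div_mul_eq_mul_div] at hb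
      rw [← sum_div, le_div_iff₀ h0, mul_comm] at hb
      simp only [g] at this
      linarith
  · obtain ⟨y, hy, hyc⟩ := Set.not_disjoint_iff.1 hd
    obtain ⟨ι, _, w, z, hw, hw1, hz, rfl⟩ := mem_convexHull_iff_exists_fintype.1 hy
    choose b hb using hz
    refine ⟨ι, inferInstance, w, b, hw, hw1, fun x => (hyc x).trans ?_⟩
    simp only [mass, Finset.sum_apply, Pi.smul_apply, smul_eq_mul, ← hb]
    exact le_rfl

/-- If any few points are simultaneously served by some `b`, then boundedly many `b`'s suffice to
serve each point of a finite set by a majority vote. -/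
theorem exists_majority (k : ℕ) : ∃ N K : ℕ, 0 < N ∧ ∀ {X : Type u} {B : Type v} [Finite X]
    [Nonempty B] {R : X → B → Prop}, ¬ FinShatters R k →
      (∀ x : Fin N → X, ∃ b, ∀ j, R (x j) b) →
      ∃ b : Fin K → B, ∀ x, ∃ S : Finset (Fin K), K < 2 * #S ∧ ∀ j ∈ S, R x (b j) := by
  classical
  obtain ⟨r, hr⟩ := exists_approximation.{u, v} k (ε := 1 / 4) (by norm_num)
  obtain ⟨s, hs⟩ := exists_approximation.{0, u} (2 ^ k) (ε := 1 / 4) (by norm_num)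
  refine ⟨2 ^ r, 2 ^ s, by positivity, fun {X B _ _ R} hR hN => ?_⟩
  have := Fintype.ofFinite X
  obtain ⟨ι, _, w, b, hw, hw1, hb⟩ := exists_mixed_strategy R (3 / 4) fun w hw hw1 => by
    obtain ⟨f, hf⟩ := hr hR w hw hw1
    obtain ⟨b, hb⟩ := hN f
    refine ⟨b, ?_⟩
    have := hf b
    have h1 : freq R f b = 1 := by simp [freq, hb]
    rw [h1, abs_lt] at this
    linarith
  obtain ⟨f, hf⟩ := hs (R := fun i x => R x (b i))
    (fun h => hR (h.of_comp (R := fun b x => R x b) b).of_swap) w hw hw1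
  refine ⟨b ∘ f, fun x => ⟨univ.filter fun j => R x (b (f j)), ?_, fun j hj => (mem_filter.1 hj).2⟩⟩
  have h1 := (abs_lt.1 (hf x)).1
  have h2 := hb x
  have h3 : 1 / 2 < freq (fun i x => R x (b i)) f x := by linarith
  rw [freq, lt_div_iff₀ (by simp), sum_boole, Fintype.card_fin] at h3
  have h4 : ((2 ^ s : ℕ) : ℝ) < 2 * (#{j | R x (b (f j))} : ℕ) := by linarith
  exact_mod_cast h4

end Combinatorics

/-! ### Ultrapowers and the formulas `θ` and `ψ` -/

open FirstOrder Language Filter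

section Logic

variable {L : FirstOrder.Language.{u, v}} {n m : ℕ}

/-- The diagonal embedding of a structure into its ultrapower. -/
def diagonalEmbedding (L : FirstOrder.Language.{u, v}) {M : Type w} [L.Structure M] [Nonempty M]
    {I : Type w} (D : Ultrafilter I) : M ↪ₑ[L] (D : Filter I).Product fun _ => M where
  toFun a := ((fun _ => a : I → M) : (D : Filter I).Product fun _ => M)
  map_formula' k φ x := by
    refine (Ultraproduct.realize_formula_cast (M := fun _ : I => M) (u := D) φ fun i _ => x i).trans ?_
    exact eventually_const

/-- Compactness: in an ultrapower over the finite sets `F`, along an ultrafilter containing every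
cone `{F | x ∈ F}`, the class of `F ↦ b F` separates. -/
theorem externallySeparable_of_finite (φ : L.Formula (Fin n ⊕ Fin m)) {M : Type w} [L.Structure M]
    [Nonempty M] {X Y : Set (Fin n → M)}
    (h : ∀ F : Finset (Fin n → M), ∃ b : Fin m → M, ∀ x ∈ F,
      (x ∈ X → φ.Realize (Sum.elim x b)) ∧ (x ∈ Y → ¬ φ.Realize (Sum.elim x b))) :
    ExternallySeparable φ X Y := by
  classical
  choose b hb using h
  let D : Ultrafilter (Finset (Fin n → M)) := Ultrafilter.of atTop
  let a : Fin m → (D : Filter (Finset (Fin n → M))).Product fun _ => M :=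
    fun j => ((fun F => b F j : Finset (Fin n → M) → M) :
      (D : Filter (Finset (Fin n → M))).Product fun _ => M)
  have key : ∀ x : Fin n → M, φ.Realize (Sum.elim (diagonalEmbedding L D ∘ x) a) ↔
      ∀ᶠ F in (D : Filter _), φ.Realize (Sum.elim x (b F)) := fun x => by
    have h1 := Ultraproduct.realize_formula_cast (u := D) φ
      (Sum.elim (fun i _ => x i) (fun j F => b F j))
    have h2 : (fun i => ((Sum.elim (fun i _ => x i) (fun j F => b F j) i :
        Finset (Fin n → M) → M) : (D : Filter (Finset (Fin n → M))).Product fun _ => M)) =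
        Sum.elim (diagonalEmbedding L D ∘ x) a := by
      funext i; cases i <;> rfl
    have h3 : ∀ F, (fun i => Sum.elim (fun i _ => x i) (fun j F => b F j) i F) =
        Sum.elim x (b F) := fun F => by
      funext i; cases i <;> rfl
    rw [h2] at h1
    simp only [h3] at h1
    exact h1
  have hmem : ∀ x : Fin n → M, ∀ᶠ F in (D : Filter (Finset (Fin n → M))), x ∈ F := fun x =>
    Ultrafilter.of_le atTop <| (eventually_ge_atTop ({x} : Finset (Fin n → M))).mono
      fun F hF => hF (Finset.mem_singleton_self x)
  refine ⟨_, inferInstance, diagonalEmbedding L D, a, fun x hx => ?_, ?_⟩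
  · exact (key x).2 ((hmem x).mono fun F hF => (hb F x hF).1 hx)
  · refine Set.eq_empty_of_forall_notMem fun x hx => ?_
    obtain ⟨F, h1, h2⟩ := (((key x).1 hx.2).and (hmem x)).exists
    exact (hb F x h2).2 hx.1 h1

/-- The formula saying of `x₁, …, x_N` that some instance of `φ` holds exactly at the `x_j` with
`j ∈ s`. -/
noncomputable def patternFormula (φ : L.Formula (Fin n ⊕ Fin m)) {N : ℕ} (s : Set (Fin N)) :
    L.Formula (Fin N × Fin n) := by
  classical
  exact Formula.iExs (Fin m) <| Formula.iInf fun j : Fin N =>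
    let φj : L.Formula ((Fin N × Fin n) ⊕ Fin m) :=
      Formula.relabel (Sum.map (fun i => (j, i)) id) φ
    if j ∈ s then φj else φj.not

theorem realize_patternFormula (φ : L.Formula (Fin n ⊕ Fin m)) {N : ℕ} (s : Set (Fin N))
    {M : Type w} [L.Structure M] (x : Fin N × Fin n → M) :
    (patternFormula φ s).Realize x ↔
      ∃ b : Fin m → M, ∀ j, φ.Realize (Sum.elim (fun i => x (j, i)) b) ↔ j ∈ s := by
  have h : ∀ (j : Fin N) (b : Fin m → M),
      (Sum.elim x b ∘ Sum.map (fun i => (j, i)) id : Fin n ⊕ Fin m → M) =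
        Sum.elim (fun i => x (j, i)) b := fun j b => by
    funext i; cases i <;> rfl
  simp only [patternFormula, Formula.realize_iExs, Formula.realize_iInf]
  refine exists_congr fun b => forall_congr' fun j => ?_
  split_ifs with hj <;> simp [Formula.realize_relabel, h, hj]

theorem ExternallySeparable.exists_pattern {φ : L.Formula (Fin n ⊕ Fin m)} {M : Type w}
    [L.Structure M] {X Y : Set (Fin n → M)} (h : ExternallySeparable φ X Y) {N : ℕ}
    (x : Fin N → Fin n → M) :
    ∃ b : Fin m → M, ∀ j, (x j ∈ X → φ.Realize (Sum.elim (x j) b)) ∧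
      (x j ∈ Y → ¬ φ.Realize (Sum.elim (x j) b)) := by
  obtain ⟨_, _, f, a, hX, hY⟩ := h
  have h1 : (patternFormula φ {j | φ.Realize (Sum.elim (f ∘ x j) a)}).Realize
      (f ∘ fun p : Fin N × Fin n => x p.1 p.2) :=
    (realize_patternFormula _ _ _).2 ⟨a, fun j => Iff.rfl⟩
  rw [f.map_formula, realize_patternFormula] at h1
  obtain ⟨b, hb⟩ := h1
  refine ⟨b, fun j => ⟨fun hj => (hb j).2 (hX hj), fun hj hφ => ?_⟩⟩
  exact (Set.eq_empty_iff_forall_notMem.1 hY (x j)) ⟨hj, (hb j).1 hφ⟩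

/-- The sentence saying that any `N` points of `U ∪ V` are separated by an instance of `φ`. -/
noncomputable def separationSentence (φ : L.Formula (Fin n ⊕ Fin m)) (N : ℕ) :
    (withUV L n).Sentence :=
  Formula.iAlls (Fin N × Fin n) <| Formula.iExs (Fin m) <| Formula.iInf fun j : Fin N =>
    let U : (withUV L n).Relations n := Sum.inr UVRel.U
    let V : (withUV L n).Relations n := Sum.inr UVRel.V
    let y : Fin n → (withUV L n).Term ((Empty ⊕ Fin N × Fin n) ⊕ Fin m) :=
      fun i => Term.var (Sum.inl (Sum.inr (j, i)))
    let φj : (withUV L n).Formula ((Empty ⊕ Fin N × Fin n) ⊕ Fin m) :=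
      Formula.relabel (Sum.map (fun i => Sum.inr (j, i)) id) (LHom.sumInl.onFormula φ)
    (U.formula y).imp φj ⊓ (V.formula y).imp φj.not

theorem enrichmentModels_separationSentence (φ : L.Formula (Fin n ⊕ Fin m)) (N : ℕ) {M : Type w}
    [L.Structure M] (U V : Set (Fin n → M)) :
    EnrichmentModels U V (separationSentence φ N) ↔
      ∀ x : Fin N → Fin n → M, ∃ b : Fin m → M, ∀ j,
        (x j ∈ U → φ.Realize (Sum.elim (x j) b)) ∧
        (x j ∈ V → ¬ φ.Realize (Sum.elim (x j) b)) := by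
  let _ := structureUV U V
  have h : ∀ (v : Empty → M) (x : Fin N × Fin n → M) (j : Fin N) (b : Fin m → M),
      (Sum.elim (Sum.elim v x) b ∘ Sum.map (fun i => Sum.inr (j, i)) id : Fin n ⊕ Fin m → M) =
        Sum.elim (fun i => x (j, i)) b := fun v x j b => by
    funext i; cases i <;> rfl
  unfold EnrichmentModels separationSentence
  simp only [Sentence.Realize, Formula.realize_iAlls, Formula.realize_iExs, Formula.realize_iInf,
    Formula.realize_inf, Formula.realize_imp, Formula.realize_not, Formula.realize_relabel,
    LHom.realize_onFormula, h]
  exact ⟨fun H x => H fun p => x p.1 p.2, fun H x => H fun j i => x (j, i)⟩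

/-- The formula `ψ(x; t₁, …, t_K)` saying that `φ(x; t_j)` holds for a majority of the `j`. -/
noncomputable def majorityFormula (φ : L.Formula (Fin n ⊕ Fin m)) (K : ℕ) :
    L.Formula (Fin n ⊕ Fin (K * m)) :=
  Formula.iSup fun s : {s : Finset (Fin K) // K < 2 * s.card} => Formula.iInf fun j : s.1 =>
    Formula.relabel (Sum.map id fun i => finProdFinEquiv ((j : Fin K), i)) φ

theorem realize_majorityFormula (φ : L.Formula (Fin n ⊕ Fin m)) {K : ℕ} {M : Type w}
    [L.Structure M] (x : Fin n → M) (b : Fin K → Fin m → M) :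
    (majorityFormula φ K).Realize
        (Sum.elim x (Function.uncurry b ∘ finProdFinEquiv.symm)) ↔
      ∃ S : Finset (Fin K), K < 2 * S.card ∧ ∀ j ∈ S, φ.Realize (Sum.elim x (b j)) := by
  have h : ∀ j : Fin K, (Sum.elim x (Function.uncurry b ∘ finProdFinEquiv.symm) ∘
      Sum.map id (fun i => finProdFinEquiv (j, i)) : Fin n ⊕ Fin m → M) =
        Sum.elim x (b j) := fun j => by
    rw [Sum.elim_comp_map]
    congr 1
    funext i
    simp only [Function.comp_apply, Equiv.symm_apply_apply, Function.uncurry]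
  simp only [majorityFormula, Formula.realize_iSup, Formula.realize_iInf, Formula.realize_relabel,
    h, Subtype.exists, Subtype.forall, exists_prop]

theorem not_finShatters_of_not_shatters {φ : L.Formula (Fin n ⊕ Fin m)} {M : Type w}
    [L.Structure M] {k : ℕ}
    (h : ∀ A : Finset (Fin n → M), A.card = k → ¬ Shatters φ (A : Set (Fin n → M))) :
    ¬ FinShatters (fun (x : Fin n → M) (b : Fin m → M) => φ.Realize (Sum.elim x b)) k := by
  classical
  rintro ⟨x, hx⟩
  have hinj : Function.Injective x := fun i j hij => by
    obtain ⟨b, hb⟩ := hx {i}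
    have h1 := (hb i).2 rfl
    rw [hij] at h1
    exact ((hb j).1 h1).symm
  refine h (Finset.univ.image x) (by simp [Finset.card_image_of_injective _ hinj]) fun C _ => ?_
  obtain ⟨b, hb⟩ := hx (x ⁻¹' C)
  refine ⟨b, fun a ha => ?_⟩
  obtain ⟨i, -, rfl⟩ := Finset.mem_image.1 ha
  exact hb i

/-- Passing from `R` to correctness of the classification by `R` does not shatter more points. -/
theorem FinShatters.of_classification {X B : Type*} {R : X → B → Prop} {U V : Set X} {k : ℕ}
    (hUV : ∀ x ∈ U, x ∉ V)
    (h : FinShatters (fun x b => (x ∈ U → R x b) ∧ (x ∈ V → ¬ R x b)) k) : FinShatters R k := by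
  obtain ⟨x, hx⟩ := h
  refine ⟨x, fun s => ?_⟩
  -- Being correct means `R` on `U` and not `R` on `V`, so the target pattern is flipped at the
  -- points outside `U`.
  obtain ⟨b, hb⟩ := hx {i | i ∈ s ↔ x i ∈ U}
  -- Each `x i` is misclassified by `c`, hence lies in `U` or `V`.
  obtain ⟨c, hc⟩ := hx ∅
  refine ⟨b, fun i => ?_⟩
  have h1 := hb i
  have h2 := hc i
  have h3 := hUV (x i)
  simp only [Set.mem_ofPred_eq, Set.mem_empty_iff_false, iff_false] at h1 h2
  tauto

end Logic

end ExtSep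

/-! ### The main theorem -/

open ExtSep in
theorem mainTheorem3 {L : FirstOrder.Language.{u, v}} (T : L.Theory) {n m : ℕ}
    (φ : L.Formula (Fin n ⊕ Fin m)) (hφ : ExtSep.IsNIP.{u, v, w} T φ) :
    ∃ (θ : (ExtSep.withUV L n).Sentence) (p : ℕ) (ψ : L.Formula (Fin n ⊕ Fin p)),
      ∀ (M : Type w) [L.Structure M] [Nonempty M] [M ⊨ T] (U V : Set (Fin n → M)),
        (ExtSep.ExternallySeparable φ U V → ExtSep.EnrichmentModels U V θ) ∧
        (ExtSep.EnrichmentModels U V θ → ExtSep.ExternallySeparable ψ U V) := by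
  obtain ⟨k, hk⟩ := hφ
  obtain ⟨N, K, hN, hmaj⟩ := exists_majority.{w, w} k
  refine ⟨separationSentence φ N, K * m, majorityFormula φ K, fun M _ _ _ U V => ⟨fun h => ?_,
    fun h => ?_⟩⟩
  · exact (enrichmentModels_separationSentence φ N U V).2 fun x => h.exists_pattern x
  rw [enrichmentModels_separationSentence] at h
  -- As `0 < N`, `θ` applied to a constant tuple makes `U` and `V` disjoint.
  have hUV : ∀ x ∈ U, x ∉ V := fun x hU hV => by
    obtain ⟨b, hb⟩ := h fun _ => x
    exact (hb ⟨0, hN⟩).2 hV ((hb ⟨0, hN⟩).1 hU)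
  refine externallySeparable_of_finite _ fun F => ?_
  obtain ⟨b, hb⟩ := hmaj (X := F) (B := Fin m → M)
    (R := fun x b => ((x : Fin n → M) ∈ U → φ.Realize (Sum.elim (x : Fin n → M) b)) ∧
      ((x : Fin n → M) ∈ V → ¬ φ.Realize (Sum.elim (x : Fin n → M) b)))
    (fun h' => not_finShatters_of_not_shatters (hk M)
      (FinShatters.of_classification hUV (h'.of_comp (R := fun x b => (x ∈ U → _) ∧ (x ∈ V → _))
        Subtype.val)))
    (fun x => h fun j => x j)
  refine ⟨Function.uncurry b ∘ finProdFinEquiv.symm, fun x hx => ?_⟩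
  rw [realize_majorityFormula]
  obtain ⟨S, hS, hSR⟩ := hb ⟨x, hx⟩
  refine ⟨fun hxU => ⟨S, hS, fun j hj => (hSR j hj).1 hxU⟩, ?_⟩
  rintro hxV ⟨S', hS', hφ⟩
  -- Two majorities among `K` indices would have to meet, but at an index in `S` the instance is
  -- correct at `x ∈ V`, so it fails there.
  have hdisj : Disjoint S S' :=
    Finset.disjoint_left.2 fun j hj hj' => (hSR j hj).2 hxV (hφ j hj')
  have hcard := (S ∪ S').card_le_univ
  rw [Finset.card_union_of_disjoint hdisj, Fintype.card_fin] at hcard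
  omega
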